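/- Let $A\in\mathbb{R}^{m\times n}$ be a matrix of rank $r$, with singular values $s_1,\dots,s_{\min\{m,n\}}$, and let $N\ge 1$ be an integer. For $p>0$ let $\|A\|_p=\big(\sum_i s_i^p\big)^{1/p}$ be the Schatten $p$-(quasi)norm, let $\|A\|_*=\sum_i s_i$ be the nuclear norm, and let $\|A\|_F$ be the Frobenius norm. Call integers $d_0,d_1,\dots,d_N\ge 0$ admissible if $d_0=m$, $d_N=n$ and $d_i\ge r$ for $1\le i\le N-1$, and consider the factorizations $$A=R_1R_2\cdots R_N,\qquad R_i\in\mathbb{R}^{d_{i-1}\times d_i}\quad(1\le i\le N).$$ 1. If $N\ge 2$, then for every choice of admissible dimensions $d_0,\dots,d_N$ that are all positive, $A$ has infinitely many such factorizations. 2. Let $p\in(0,1]$ and $p_1,\dots,p_N>0$ satisfy $\sum_{i=1}^N \frac1{p_i}=\frac1p$. Then $$\|A\|_p=\min_{A=R_1\cdots R_N}\Big(p\sum_{i=1}^N\frac1{p_i}\|R_i\|_{p_i}^{p_i}\Big)^{1/p},$$ where the minimum is attained. This holds when the minimum is over all factorizations with any one fixed choice of admissible dimensions $d_0,\dots,d_N$,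 and also when it is over all factorizations with all admissible choices of dimensions. 3. In particular, $$\|A\|_*=\min_{R_1R_2=A}\tfrac12\big(\|R_1\|_F^2+\|R_2\|_F^2\big),$$ where the minimum is attained, both over $R_1\in\mathbb{R}^{m\times k}$, $R_2\in\mathbb{R}^{k\times n}$ for any fixed $k\ge r$, and over all such factorizations with arbitrary $k$. -/

import Mathlib

/-- The `i`-th singular value (`i = 0, 1, 2, …`, in decreasing order) of the real matrix `A`,
regarded as a linear map between Euclidean spaces; it is `0` for `min m n ≤ i`. -/
noncomputable def singularValue {m n : ℕ} (A : Matrix (Fin m) (Fin n) ℝ) (i : ℕ) : ℝ :=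
  (Matrix.toEuclideanLin A).singularValues i

/-- The Schatten `p`-(quasi)norm `(∑ i, s_i ^ p) ^ (1 / p)`, the sum being over the `min m n`
singular values of `A`. -/
noncomputable def schattenNorm (p : ℝ) {m n : ℕ} (A : Matrix (Fin m) (Fin n) ℝ) : ℝ :=
  (∑ i ∈ Finset.range (min m n), singularValue A i ^ p) ^ (1 / p)

/-- The nuclear norm: the sum of the singular values. -/
noncomputable def nuclearNorm {m n : ℕ} (A : Matrix (Fin m) (Fin n) ℝ) : ℝ :=
  ∑ i ∈ Finset.range (min m n), singularValue A i

/-- The Frobenius norm: the square root of the sum of the squares of the entries. -/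
noncomputable def frobeniusNorm {m n : ℕ} (A : Matrix (Fin m) (Fin n) ℝ) : ℝ :=
  Real.sqrt (∑ i, ∑ j, A i j ^ 2)

/-- `N` real matrices of composable sizes: the `i`-th one is of size `d i × d (i + 1)`, for
`i = 0, …, N - 1`. -/
abbrev FactorChain {N : ℕ} (d : Fin (N + 1) → ℕ) : Type :=
  (i : Fin N) → Matrix (Fin (d i.castSucc)) (Fin (d i.succ)) ℝ

/-- The ordered product `R 0 * R 1 * ⋯ * R (N - 1)`. -/
def chainProd : {N : ℕ} → (d : Fin (N + 1) → ℕ) → FactorChain d →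
    Matrix (Fin (d 0)) (Fin (d (Fin.last N))) ℝ
  | 0, d, _ => (1 : Matrix (Fin (d 0)) (Fin (d 0)) ℝ)
  | _ + 1, d, R => R 0 * chainProd (fun i => d i.succ) (fun i => R i.succ)

/-- The sizes `d 0, …, d N` are those of a chain of `N` matrices whose product is an `m × n` matrix
and whose inner dimensions `d 1, …, d (N - 1)` are all at least `r`. -/
def AdmissibleDims (m n r : ℕ) {N : ℕ} (d : Fin (N + 1) → ℕ) : Prop :=
  d 0 = m ∧ d (Fin.last N) = n ∧ ∀ i, i ≠ 0 → i ≠ Fin.last N → r ≤ d i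

/-- The factorizations `A = R 0 * ⋯ * R (N - 1)` with factors of the sizes prescribed by `d`
(which has to start at `m` and to end at `n`). -/
def factorizations {m n N : ℕ} (A : Matrix (Fin m) (Fin n) ℝ) (d : Fin (N + 1) → ℕ) :
    Set (FactorChain d) :=
  {R | ∃ (h₀ : d 0 = m) (h₁ : d (Fin.last N) = n),
    chainProd d R = A.submatrix (Fin.cast h₀) (Fin.cast h₁)}

/-- The objective `(p * ∑ i, (1 / q i) * ‖R i‖_{q i} ^ (q i)) ^ (1 / p)`. -/
noncomputable def factorCost {N : ℕ} {d : Fin (N + 1) → ℕ} (p : ℝ) (q : Fin N → ℝ)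
    (R : FactorChain d) : ℝ :=
  (p * ∑ i, (1 / q i) * schattenNorm (q i) (R i) ^ (q i)) ^ (1 / p)

open Matrix Finset

/-! Lower bound: Horn's inequality (`prod_singularValue_mul_le`) bounds the product of the `k`
largest singular values of a product by those of its factors. By `sum_le_sum_of_prod_le_prod` these
product inequalities pass to sums of `p`-th powers, and weighted AM-GM with weights `p / q j`, which
sum to 1, splits each term into the cost.

Attainment: from a thin SVD `A = U Σ Vᵀ`, take the factors `E i * Σ ^ (p / q i) * (E (i + 1))ᵀ` with
orthonormal columns in each `E i`, `U` and `V` at the ends. Inner sizes at least the rank let such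
`E i` exist. All terms of AM-GM are then equal.

Infinitude comes from rescaling the first two factors by `exp c` and `exp (-c)`; the nuclear norm is
the case `p = 1`, `q = (2, 2)`. -/

/-- Cauchy–Binet, summed over all maps instead of subsets of rows: each subset is counted `(card
κ)!` times, and non-injective maps contribute 0. -/
theorem factorial_mul_det_transpose_mul {ι κ R : Type*} [Fintype ι] [Fintype κ] [DecidableEq κ]
    [CommRing R] (Y X : Matrix ι κ R) :
    ((Fintype.card κ).factorial : R) * (Yᵀ * X).det =
      ∑ f : κ → ι, (Y.submatrix f id).det * (X.submatrix f id).det := by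
  classical
  have h1 : (Yᵀ * X).det = ∑ f : κ → ι, (∏ i, X (f i) i) * (Y.submatrix f id).det := by
    rw [det_apply']
    simp only [transpose_apply, mul_apply, Finset.prod_univ_sum, Finset.mul_sum]
    rw [Finset.sum_comm]
    simp only [Fintype.piFinset_univ]
    refine Finset.sum_congr rfl fun f _ => ?_
    rw [← det_transpose (Y.submatrix f id), det_apply', Finset.mul_sum]
    refine Finset.sum_congr rfl fun σ _ => ?_
    simp only [transpose_apply, submatrix_apply, id, Finset.prod_mul_distrib]
    ring
  -- Reindexing by `τ` brings out its sign; summing over all `τ` then assembles the second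
  -- determinant.
  have h2 (τ : Equiv.Perm κ) : (Yᵀ * X).det =
      ∑ f : κ → ι, ((Equiv.Perm.sign τ : ℤ) : R) * (∏ i, X (f (τ i)) i) *
        (Y.submatrix f id).det := by
    rw [h1, ← (Equiv.arrowCongr τ (Equiv.refl ι)).symm.sum_comp]
    refine Finset.sum_congr rfl fun f _ => ?_
    have : Y.submatrix ((Equiv.arrowCongr τ (Equiv.refl ι)).symm f) id =
        (Y.submatrix f id).submatrix τ id := by
      ext i j; simp
    rw [this, det_permute]
    simp
    ring
  have h3 : ∑ τ : Equiv.Perm κ, (Yᵀ * X).det = ((Fintype.card κ).factorial : R) * (Yᵀ * X).det := by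
    simp [Fintype.card_perm]
  rw [← h3, Finset.sum_congr rfl fun τ _ => h2 τ, Finset.sum_comm]
  refine Finset.sum_congr rfl fun f _ => ?_
  rw [← Finset.sum_mul, mul_comm]
  congr 1
  rw [det_apply']
  simp

theorem prod_le_prod_range_card {a : ℕ → ℝ} (ha : Antitone a) (h0 : ∀ i, 0 ≤ a i) (s : Finset ℕ) :
    ∏ i ∈ s, a i ≤ ∏ i ∈ range s.card, a i := by
  induction s using Finset.induction_on_max with
  | empty => simp
  | insert m s hm ih =>
    have hms : m ∉ s := fun h => lt_irrefl _ (hm m h)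
    rw [prod_insert hms, card_insert_of_notMem hms, prod_range_succ, mul_comm]
    have : s.card ≤ m := by
      simpa using card_le_card (t := range m) fun x hx => mem_range.2 (hm x hx)
    exact mul_le_mul ih (ha this) (h0 _) (prod_nonneg fun _ _ => h0 _)

theorem transpose_mul_self_submatrix_castLE {n k : ℕ} (hk : k ≤ n) {W : Matrix (Fin n) (Fin n) ℝ}
    (hW : Wᵀ * W = 1) :
    (W.submatrix id (Fin.castLE hk))ᵀ * W.submatrix id (Fin.castLE hk) = 1 := by
  have h : (W.submatrix id (Fin.castLE hk))ᵀ * W.submatrix id (Fin.castLE hk) =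
      (Wᵀ * W).submatrix (Fin.castLE hk) (Fin.castLE hk) := by
    ext i j
    simp [mul_apply]
  rw [h, hW]
  ext i j
  simp [one_apply, Fin.ext_iff]

/-! ### Gram matrices and Horn's inequality -/

section SingularValues

variable {m n l : ℕ} (A : Matrix (Fin m) (Fin n) ℝ)

theorem singularValue_nonneg (i : ℕ) : 0 ≤ singularValue A i :=
  LinearMap.singularValues_nonneg _ i

theorem singularValue_antitone : Antitone (singularValue A) :=
  LinearMap.singularValues_antitone _

theorem singularValue_pos_iff {i : ℕ} : 0 < singularValue A i ↔ i < A.rank := by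
  rw [singularValue, LinearMap.singularValues_pos_iff_lt_finrank_range,
    A.rank_eq_finrank_range_toLin (EuclideanSpace.basisFun _ ℝ).toBasis
      (EuclideanSpace.basisFun _ ℝ).toBasis, toEuclideanLin_eq_toLin_orthonormal]

theorem singularValue_eq_zero {i : ℕ} (hi : A.rank ≤ i) : singularValue A i = 0 :=
  le_antisymm (not_lt.1 fun h => absurd ((singularValue_pos_iff A).1 h) hi.not_gt)
    (singularValue_nonneg A i)

theorem rank_le_min : A.rank ≤ min m n :=
  le_min (A.rank_le_height) (A.rank_le_width)

theorem exists_gram_eq : ∃ W : Matrix (Fin n) (Fin n) ℝ, Wᵀ * W = 1 ∧ W * Wᵀ = 1 ∧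
    Aᵀ * A = W * diagonal (fun i : Fin n => singularValue A i ^ 2) * Wᵀ := by
  set T := toEuclideanLin A
  have hS := T.isSymmetric_adjoint_comp_self
  have hn : Module.finrank ℝ (EuclideanSpace ℝ (Fin n)) = n := by simp
  set b := hS.eigenvectorBasis hn
  let W : Matrix (Fin n) (Fin n) ℝ := of fun j i => b i j
  have hW : Wᵀ * W = 1 := by
    ext i j
    have := orthonormal_iff_ite.1 b.orthonormal i j
    rw [mul_apply, one_apply, ← this, PiLp.inner_apply]
    simp [W, mul_comm]
  have hW' : W * Wᵀ = 1 := mul_eq_one_comm.1 hW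
  refine ⟨W, hW, hW', ?_⟩
  have key : Aᵀ * A * W = W * diagonal (fun i : Fin n => singularValue A i ^ 2) := by
    ext j i
    have h := hS.apply_eigenvectorBasis hn i
    have h2 : (toEuclideanLin Aᵀ) (T (b i)) = (singularValue A i ^ 2) • b i := by
      rw [singularValue, LinearMap.sq_singularValues_fin _ hn i]
      have : (toEuclideanLin Aᵀ) = LinearMap.adjoint T := by
        rw [← toEuclideanLin_conjTranspose_eq_adjoint, conjTranspose_eq_transpose_of_trivial]
      rw [this]
      exact h
    have h3 := congrArg (fun v => v j) h2
    simp only [T, toLpLin_apply, PiLp.smul_apply, smul_eq_mul, mulVec_mulVec] at h3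
    rw [mul_diagonal, mul_comm]
    exact h3
  rw [← key, Matrix.mul_assoc, hW', Matrix.mul_one]

/-- Cauchy–Binet on both sides reduces this to a termwise comparison: an injective `f` picks `k`
distinct entries of `a`, whose product is at most that of the first `k`. -/
theorem det_transpose_mul_diagonal_mul_le {k : ℕ} {a : ℕ → ℝ} (ha : Antitone a)
    (h0 : ∀ i, 0 ≤ a i) (X : Matrix (Fin n) (Fin k) ℝ) :
    (Xᵀ * diagonal (fun i : Fin n => a i) * X).det ≤
      (∏ i ∈ range k, a i) * (Xᵀ * X).det := by
  have hk : (0 : ℝ) < ((Fintype.card (Fin k)).factorial : ℝ) := by positivity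
  refine le_of_mul_le_mul_left ?_ hk
  have hX : Xᵀ * diagonal (fun i : Fin n => a i) = (diagonal (fun i : Fin n => a i) * X)ᵀ := by
    simp
  rw [hX, factorial_mul_det_transpose_mul, mul_left_comm, factorial_mul_det_transpose_mul, mul_sum]
  refine sum_le_sum fun f _ => ?_
  have hf : ((diagonal (fun i : Fin n => a i) * X).submatrix f id) =
      diagonal (fun i => a (f i)) * X.submatrix f id := by
    ext i j; simp
  rw [hf, det_mul, det_diagonal, mul_assoc]
  by_cases hinj : Function.Injective f
  · refine mul_le_mul_of_nonneg_right ?_ (mul_self_nonneg _)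
    have h := prod_le_prod_range_card ha h0 (univ.image fun i => (f i : ℕ))
    have hi : Function.Injective fun i => (f i : ℕ) := Fin.val_injective.comp hinj
    rwa [prod_image hi.injOn, card_image_of_injective _ hi, card_univ, Fintype.card_fin] at h
  · obtain ⟨i, j, hij, hne⟩ := by simpa [Function.Injective] using hinj
    have : (X.submatrix f id).det = 0 := det_zero_of_row_eq hne (by ext; simp [hij])
    simp [this]

theorem det_gram_mul_le {k : ℕ} (V : Matrix (Fin n) (Fin k) ℝ) :
    ((A * V)ᵀ * (A * V)).det ≤ (∏ i ∈ range k, singularValue A i) ^ 2 * (Vᵀ * V).det := by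
  obtain ⟨W, -, hW, hA⟩ := exists_gram_eq A
  have ha : Antitone fun i => singularValue A i ^ 2 := fun i j hij =>
    pow_le_pow_left₀ (singularValue_nonneg A j) (singularValue_antitone A hij) 2
  have h := det_transpose_mul_diagonal_mul_le ha (fun i => sq_nonneg _) (Wᵀ * V)
  rw [prod_pow] at h
  have e1 : (A * V)ᵀ * (A * V) = (Wᵀ * V)ᵀ *
      diagonal (fun i : Fin n => singularValue A i ^ 2) * (Wᵀ * V) := by
    rw [transpose_mul, transpose_mul, transpose_transpose, Matrix.mul_assoc, ← Matrix.mul_assoc Aᵀ, hA]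
    simp only [Matrix.mul_assoc]
  have e2 : (Wᵀ * V)ᵀ * (Wᵀ * V) = Vᵀ * V := by
    rw [transpose_mul, transpose_transpose, Matrix.mul_assoc, ← Matrix.mul_assoc W, hW, Matrix.one_mul]
  rwa [e2, ← e1] at h

theorem exists_right_singular_vectors {k : ℕ} (hk : k ≤ n) :
    ∃ V : Matrix (Fin n) (Fin k) ℝ, Vᵀ * V = 1 ∧
      (A * V)ᵀ * (A * V) = diagonal fun i : Fin k => singularValue A i ^ 2 := by
  obtain ⟨W, hW, -, hA⟩ := exists_gram_eq A
  have hV : ∀ M : Matrix (Fin n) (Fin n) ℝ, (W.submatrix id (Fin.castLE hk))ᵀ * M *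
      W.submatrix id (Fin.castLE hk) = (Wᵀ * M * W).submatrix (Fin.castLE hk) (Fin.castLE hk) := by
    intro M
    ext i j
    simp [mul_apply]
  refine ⟨W.submatrix id (Fin.castLE hk), transpose_mul_self_submatrix_castLE hk hW, ?_⟩
  · rw [transpose_mul, Matrix.mul_assoc, ← Matrix.mul_assoc Aᵀ, ← Matrix.mul_assoc, hV, hA]
    have : Wᵀ * (W * diagonal (fun i : Fin n => singularValue A i ^ 2) * Wᵀ) * W =
        diagonal (fun i : Fin n => singularValue A i ^ 2) := by
      rw [Matrix.mul_assoc, Matrix.mul_assoc, hW, Matrix.mul_one, ← Matrix.mul_assoc, hW, Matrix.one_mul]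
    rw [this]
    ext i j
    simp [diagonal_apply, Fin.ext_iff]

/-- Horn's inequality. -/
theorem prod_singularValue_mul_le (B : Matrix (Fin n) (Fin l) ℝ) (k : ℕ) :
    ∏ i ∈ range k, singularValue (A * B) i ≤
      (∏ i ∈ range k, singularValue A i) * ∏ i ∈ range k, singularValue B i := by
  have hA := prod_nonneg fun i (_ : i ∈ range k) => singularValue_nonneg A i
  have hB := prod_nonneg fun i (_ : i ∈ range k) => singularValue_nonneg B i
  rcases le_or_gt k l with hk | hk
  -- For the top right singular vectors `V` of `A * B` the Gram determinant is exactly the squared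
  -- product; it is bounded by peeling off `A` on `B * V`, then `B` on `V`.
  · obtain ⟨V, hV, h⟩ := exists_right_singular_vectors (A * B) hk
    have h1 := det_gram_mul_le A (B * V)
    have h2 := det_gram_mul_le B V
    rw [← Matrix.mul_assoc A B V, h, det_diagonal,
      Fin.prod_univ_eq_prod_range (fun i => singularValue (A * B) i ^ 2), prod_pow] at h1
    rw [hV, det_one, mul_one] at h2
    refine abs_le_of_sq_le_sq' ?_ (mul_nonneg hA hB) |>.2
    rw [mul_pow]
    exact h1.trans (mul_le_mul_of_nonneg_left h2 (sq_nonneg _))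
  · rw [prod_eq_zero (mem_range.2 hk) (singularValue_eq_zero _ (rank_le_width _))]
    exact mul_nonneg hA hB

end SingularValues
-- From products to sums: the lower bound
-- For positive terms `b - a ≥ a * log (b / a)`, and Abel summation against the antitone `a` makes
-- the sum of the right-hand sides nonnegative. If the last `a n` vanishes, logarithms are avoided
-- by induction.
theorem sum_le_sum_of_prod_le_prod {a b : ℕ → ℝ} (ha : Antitone a) (ha0 : ∀ i, 0 ≤ a i)
    (hb0 : ∀ i, 0 ≤ b i) (h : ∀ k, ∏ i ∈ range k, a i ≤ ∏ i ∈ range k, b i) (n : ℕ) :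
    ∑ i ∈ range n, a i ≤ ∑ i ∈ range n, b i := by
  induction n with
  | zero => simp
  | succ n ih =>
  rcases (ha0 n).eq_or_lt with hn | hn
  · rw [sum_range_succ, sum_range_succ, ← hn]
    exact add_le_add ih (hb0 n)
  have hapos : ∀ i ∈ range (n + 1), 0 < a i := fun i hi =>
    hn.trans_le (ha (Nat.lt_succ_iff.1 (mem_range.1 hi)))
  have hbpos : ∀ i ∈ range (n + 1), 0 < b i := by
    have h1 := (prod_pos hapos).trans_le (h (n + 1))
    exact fun i hi => (hb0 i).lt_of_ne' (prod_ne_zero_iff.1 h1.ne' i hi)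
  have hL : ∀ k ≤ n + 1, 0 ≤ ∑ i ∈ range k, (Real.log (b i) - Real.log (a i)) := by
    intro k hk
    have hsub : ∀ i ∈ range k, i ∈ range (n + 1) := fun i hi =>
      mem_range.2 ((mem_range.1 hi).trans_le hk)
    rw [sum_sub_distrib, ← Real.log_prod fun i hi => (hbpos i (hsub i hi)).ne',
      ← Real.log_prod fun i hi => (hapos i (hsub i hi)).ne', sub_nonneg]
    exact Real.log_le_log (prod_pos fun i hi => hapos i (hsub i hi)) (h k)
  have habel : ∀ k ≤ n + 1, a k * ∑ i ∈ range k, (Real.log (b i) - Real.log (a i)) ≤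
      ∑ i ∈ range k, a i * (Real.log (b i) - Real.log (a i)) := by
    intro k
    induction k with
    | zero => simp
    | succ k ihk =>
      intro hk
      refine (mul_le_mul_of_nonneg_right (ha k.le_succ) (hL _ hk)).trans ?_
      rw [sum_range_succ, sum_range_succ, mul_add]
      exact add_le_add (ihk (by omega)) le_rfl
  have hnonneg := (mul_nonneg (ha0 (n + 1)) (hL _ le_rfl)).trans (habel _ le_rfl)
  have hpt : ∀ i ∈ range (n + 1), a i * (Real.log (b i) - Real.log (a i)) ≤ b i - a i := by
    intro i hi
    have hai := hapos i hi
    have hbi := hbpos i hi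
    rw [← Real.log_div hbi.ne' hai.ne']
    have h1 := mul_le_mul_of_nonneg_left (Real.log_le_sub_one_of_pos (div_pos hbi hai)) hai.le
    rwa [mul_sub, mul_div_cancel₀ _ hai.ne', mul_one] at h1
  have := sum_le_sum hpt
  rw [sum_sub_distrib] at this
  linarith

/-- Serves the empty chain, whose product is the identity. -/
theorem singularValue_one_le_one (n i : ℕ) :
    singularValue (1 : Matrix (Fin n) (Fin n) ℝ) i ≤ 1 := by
  rcases lt_or_ge i n with hi | hi
  · obtain ⟨V, hV, h⟩ := exists_right_singular_vectors (1 : Matrix (Fin n) (Fin n) ℝ) le_rfl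
    rw [Matrix.one_mul, hV] at h
    have := congrFun (congrFun h ⟨i, hi⟩) ⟨i, hi⟩
    simp only [one_apply_eq, diagonal_apply_eq] at this
    exact (sq_le_one_iff₀ (singularValue_nonneg _ _)).1 this.ge
  · rw [singularValue_eq_zero _ ((rank_le_width _).trans hi)]
    exact zero_le_one

theorem prod_singularValue_chainProd_le {N : ℕ} (d : Fin (N + 1) → ℕ) (R : FactorChain d) (k : ℕ) :
    ∏ i ∈ range k, singularValue (chainProd d R) i ≤
      ∏ i ∈ range k, ∏ j, singularValue (R j) i := by
  induction N with
  | zero =>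
    simp only [chainProd, univ_eq_empty, prod_empty]
    exact prod_le_prod (fun _ _ => singularValue_nonneg _ _) fun _ _ => singularValue_one_le_one _ _
  | succ N ih =>
    simp only [Fin.prod_univ_succ, prod_mul_distrib]
    refine (prod_singularValue_mul_le (R 0) _ k).trans ?_
    exact mul_le_mul_of_nonneg_left (ih (fun i => d i.succ) fun i => R i.succ)
      (prod_nonneg fun _ _ => singularValue_nonneg _ _)

theorem sum_singularValue_chainProd_rpow_le {N : ℕ} (d : Fin (N + 1) → ℕ) (R : FactorChain d)
    {p : ℝ} {q : Fin N → ℝ} (hp : 0 < p) (hq : ∀ j, 0 < q j) (hpq : ∑ j, 1 / q j = 1 / p) (K : ℕ) :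
    ∑ i ∈ range K, singularValue (chainProd d R) i ^ p ≤
      p * ∑ j, (1 / q j) * ∑ i ∈ range K, singularValue (R j) i ^ q j := by
  have h1 : ∑ i ∈ range K, singularValue (chainProd d R) i ^ p ≤
      ∑ i ∈ range K, (∏ j, singularValue (R j) i) ^ p := by
    refine sum_le_sum_of_prod_le_prod
      (fun i j hij => Real.rpow_le_rpow (singularValue_nonneg _ _) (singularValue_antitone _ hij)
        hp.le)
      (fun i => Real.rpow_nonneg (singularValue_nonneg _ _) _)
      (fun i => Real.rpow_nonneg (prod_nonneg fun _ _ => singularValue_nonneg _ _) _)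
      (fun k => ?_) K
    rw [Real.finsetProd_rpow _ _ fun i _ => singularValue_nonneg _ _,
      Real.finsetProd_rpow _ _ fun i _ => prod_nonneg fun _ _ => singularValue_nonneg _ _]
    exact Real.rpow_le_rpow (prod_nonneg fun _ _ => singularValue_nonneg _ _)
      (prod_singularValue_chainProd_le d R k) hp.le
  have h2 : ∀ i, (∏ j, singularValue (R j) i) ^ p ≤
      ∑ j, p / q j * singularValue (R j) i ^ q j := by
    intro i
    have h := Real.geom_mean_le_arith_mean_weighted univ (fun j => p / q j)
      (fun j => singularValue (R j) i ^ q j) (fun j _ => (div_pos hp (hq j)).le)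
      (by simp only [div_eq_mul_one_div p, ← mul_sum, hpq]
          exact mul_one_div_cancel hp.ne')
      (fun j _ => Real.rpow_nonneg (singularValue_nonneg _ _) _)
    refine le_of_eq_of_le ?_ h
    rw [← Real.finsetProd_rpow _ _ fun j _ => singularValue_nonneg _ _]
    refine prod_congr rfl fun j _ => ?_
    rw [← Real.rpow_mul (singularValue_nonneg _ _), mul_div_cancel₀ _ (hq j).ne']
  refine h1.trans ((sum_le_sum fun i _ => h2 i).trans_eq ?_)
  rw [sum_comm, mul_sum]
  refine sum_congr rfl fun j _ => ?_
  rw [mul_sum, mul_sum]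
  refine sum_congr rfl fun i _ => ?_
  ring

/-! ### Schatten norms as power sums, and the thin SVD -/

section PowerSums

variable {m n : ℕ} (A : Matrix (Fin m) (Fin n) ℝ)

theorem sum_range_singularValue_rpow {q : ℝ} (hq : q ≠ 0) {K : ℕ} (hK : A.rank ≤ K) :
    ∑ i ∈ range K, singularValue A i ^ q = ∑ i ∈ range A.rank, singularValue A i ^ q := by
  refine (sum_subset (range_mono hK) fun i _ hi => ?_).symm
  rw [singularValue_eq_zero A (by simpa using hi), Real.zero_rpow hq]

theorem schattenNorm_rpow {q : ℝ} (hq : 0 < q) :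
    schattenNorm q A ^ q = ∑ i ∈ range A.rank, singularValue A i ^ q := by
  rw [schattenNorm, ← Real.rpow_mul, one_div_mul_cancel hq.ne', Real.rpow_one,
    sum_range_singularValue_rpow A hq.ne' (rank_le_min A)]
  exact sum_nonneg fun _ _ => Real.rpow_nonneg (singularValue_nonneg _ _) _

theorem schattenNorm_nonneg (q : ℝ) : 0 ≤ schattenNorm q A :=
  Real.rpow_nonneg (sum_nonneg fun _ _ => Real.rpow_nonneg (singularValue_nonneg _ _) _) _

theorem schattenNorm_chainProd_le_factorCost {N : ℕ} (d : Fin (N + 1) → ℕ) (R : FactorChain d)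
    {p : ℝ} {q : Fin N → ℝ} (hp : 0 < p) (hq : ∀ j, 0 < q j) (hpq : ∑ j, 1 / q j = 1 / p) :
    schattenNorm p (chainProd d R) ≤ factorCost p q R := by
  -- The cutoff exceeds every rank involved, so all truncated sums are full power sums despite the
  -- different sizes.
  have hle := sum_singularValue_chainProd_rpow_le d R hp hq hpq
    ((chainProd d R).rank + ∑ j, (R j).rank)
  rw [sum_range_singularValue_rpow _ hp.ne' (Nat.le_add_right _ _), ← schattenNorm_rpow _ hp] at hle
  have hR : ∀ j, ∑ i ∈ range ((chainProd d R).rank + ∑ j, (R j).rank),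
      singularValue (R j) i ^ q j = schattenNorm (q j) (R j) ^ q j := by
    intro j
    rw [schattenNorm_rpow _ (hq j), sum_range_singularValue_rpow _ (hq j).ne']
    exact (single_le_sum (f := fun j => (R j).rank) (fun _ _ => Nat.zero_le _) (mem_univ j)).trans
      (Nat.le_add_left _ _)
  simp only [hR] at hle
  rw [factorCost, one_div p]
  exact (Real.le_rpow_inv_iff_of_pos (schattenNorm_nonneg _ _)
    ((Real.rpow_nonneg (schattenNorm_nonneg _ _) _).trans hle) hp).2 hle

open Polynomial in
theorem charpoly_gram : (Aᵀ * A).charpoly = ∏ i : Fin n, (X - C (singularValue A i ^ 2)) := by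
  obtain ⟨W, hW, -, hA⟩ := exists_gram_eq A
  rw [hA, charpoly_mul_comm, ← Matrix.mul_assoc, hW, Matrix.one_mul, charpoly_diagonal]

-- The Gram matrix and `diagonal (w ^ 2)` have the same characteristic polynomial up to powers of
-- `X`. Summing `x ^ (q / 2)` over the roots ignores the extra zeros.
open Polynomial in
theorem sum_singularValue_rpow_mul_diagonal_mul {r : ℕ} {E : Matrix (Fin m) (Fin r) ℝ}
    {F : Matrix (Fin n) (Fin r) ℝ} (hE : Eᵀ * E = 1) (hF : Fᵀ * F = 1) {w : Fin r → ℝ}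
    (hw : ∀ k, 0 ≤ w k) {q : ℝ} (hq : 0 < q) :
    ∑ i : Fin n, singularValue (E * diagonal w * Fᵀ) i ^ q = ∑ k, w k ^ q := by
  have hgram : (E * diagonal w * Fᵀ)ᵀ * (E * diagonal w * Fᵀ) =
      F * (diagonal (fun k => w k ^ 2) * Fᵀ) := by
    have : diagonal (fun k => w k ^ 2) = diagonal w * (Eᵀ * E) * diagonal w := by
      rw [hE, Matrix.mul_one, diagonal_mul_diagonal]
      simp only [sq]
    rw [this]
    simp only [transpose_mul, transpose_transpose, diagonal_transpose, Matrix.mul_assoc]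
  have h := charpoly_mul_comm' F (diagonal (fun k => w k ^ 2) * Fᵀ)
  rw [← hgram, charpoly_gram, Matrix.mul_assoc (diagonal _), hF, Matrix.mul_one, charpoly_diagonal] at h
  have hne : ∀ {ι : Type} [Fintype ι] (c : ι → ℝ), ∏ i, (X - C (c i)) ≠ 0 := fun c =>
    prod_ne_zero_iff.2 fun i _ => X_sub_C_ne_zero _
  have hroots := congrArg (fun P : ℝ[X] => (P.roots.map fun x => x ^ (q / 2)).sum) h
  rw [roots_mul (mul_ne_zero (pow_ne_zero _ X_ne_zero) (hne _)),
    roots_mul (mul_ne_zero (pow_ne_zero _ X_ne_zero) (hne _)),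
    roots_prod _ _ (hne _), roots_prod _ _ (hne _)] at hroots
  have hsq : ∀ x : ℝ, 0 ≤ x → (x ^ 2) ^ (q / 2) = x ^ q := by
    intro x hx
    rw [← Real.rpow_natCast, ← Real.rpow_mul hx]
    congr 1
    push_cast
    ring
  simp only [roots_X_sub_C, Multiset.bind_singleton, roots_X_pow, Multiset.map_add,
    Multiset.map_nsmul, Multiset.map_singleton, Real.zero_rpow (half_pos hq).ne',
    Multiset.sum_add, Multiset.sum_nsmul, Multiset.sum_singleton, smul_zero, zero_add,
    Multiset.map_map, Function.comp_apply] at hroots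
  rw [← sum_eq_multiset_sum, ← sum_eq_multiset_sum] at hroots
  simpa only [hsq _ (singularValue_nonneg _ _), hsq _ (hw _)] using hroots

theorem schattenNorm_rpow_mul_diagonal_mul {r : ℕ} {E : Matrix (Fin m) (Fin r) ℝ}
    {F : Matrix (Fin n) (Fin r) ℝ} (hE : Eᵀ * E = 1) (hF : Fᵀ * F = 1) {w : Fin r → ℝ}
    (hw : ∀ k, 0 ≤ w k) {q : ℝ} (hq : 0 < q) :
    schattenNorm q (E * diagonal w * Fᵀ) ^ q = ∑ k, w k ^ q := by
  rw [schattenNorm_rpow _ hq, ← sum_singularValue_rpow_mul_diagonal_mul hE hF hw hq,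
    Fin.sum_univ_eq_sum_range (fun i => singularValue (E * diagonal w * Fᵀ) i ^ q) n,
    sum_range_singularValue_rpow _ hq.ne' (rank_le_width _)]

theorem frobeniusNorm_sq : frobeniusNorm A ^ 2 = schattenNorm 2 A ^ (2 : ℝ) := by
  obtain ⟨W, hW, -, hA⟩ := exists_gram_eq A
  have h1 : (Aᵀ * A).trace = ∑ i, ∑ j, A i j ^ 2 := by
    rw [sum_comm]
    simp [trace, mul_apply, sq]
  have h2 : (Aᵀ * A).trace = ∑ i : Fin n, singularValue A i ^ 2 := by
    rw [hA, trace_mul_comm, ← Matrix.mul_assoc, hW, Matrix.one_mul, trace_diagonal]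
  have h3 : frobeniusNorm A ^ 2 = ∑ i, ∑ j, A i j ^ 2 :=
    Real.sq_sqrt (sum_nonneg fun _ _ => sum_nonneg fun _ _ => sq_nonneg _)
  rw [h3, ← h1, h2, schattenNorm_rpow _ two_pos,
    ← sum_range_singularValue_rpow A two_ne_zero (rank_le_width A),
    Fin.sum_univ_eq_sum_range (fun i => singularValue A i ^ 2) n]
  simp

theorem nuclearNorm_eq_schattenNorm : nuclearNorm A = schattenNorm 1 A := by
  simp [nuclearNorm, schattenNorm]

theorem exists_singular_value_decomposition :
    ∃ (U : Matrix (Fin m) (Fin A.rank) ℝ) (V : Matrix (Fin n) (Fin A.rank) ℝ),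
      Uᵀ * U = 1 ∧ Vᵀ * V = 1 ∧
        A = U * diagonal (fun k : Fin A.rank => singularValue A k) * Vᵀ := by
  obtain ⟨W, hW, -, hA⟩ := exists_gram_eq A
  set r := A.rank
  have hr : r ≤ n := rank_le_width A
  set V := W.submatrix id (Fin.castLE hr)
  have hV : Vᵀ * V = 1 := transpose_mul_self_submatrix_castLE hr hW
  have hG : Aᵀ * A = V * diagonal (fun k : Fin r => singularValue A k ^ 2) * Vᵀ := by
    rw [hA]
    ext i j
    rw [mul_apply, mul_apply]
    simp only [mul_diagonal, transpose_apply]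
    symm
    refine Fintype.sum_of_injective (Fin.castLE hr) (Fin.castLE_injective hr) _ _ (fun k hk => ?_)
      fun k => by simp [V]
    have : r ≤ k := by
      by_contra! hlt
      exact hk ⟨⟨k, hlt⟩, rfl⟩
    simp [singularValue_eq_zero A this]
  -- `A * (1 - V * Vᵀ)` has zero Gram matrix, hence vanishes.
  have hAV : A * V * Vᵀ = A := by
    have h0 : Vᵀ * (1 - V * Vᵀ) = 0 := by
      rw [Matrix.mul_sub, Matrix.mul_one, ← Matrix.mul_assoc, hV, Matrix.one_mul, sub_self]
    have h1 : (A * (1 - V * Vᵀ))ᵀ * (A * (1 - V * Vᵀ)) = 0 := by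
      rw [transpose_mul, Matrix.mul_assoc, ← Matrix.mul_assoc Aᵀ, hG, Matrix.mul_assoc _ Vᵀ, h0,
        Matrix.mul_zero, Matrix.mul_zero]
    rw [← conjTranspose_eq_transpose_of_trivial, conjTranspose_mul_self_eq_zero, Matrix.mul_sub,
      Matrix.mul_one, sub_eq_zero, ← Matrix.mul_assoc] at h1
    exact h1.symm
  have hpos : ∀ k : Fin r, singularValue A k ≠ 0 := fun k =>
    ((singularValue_pos_iff A).2 k.2).ne'
  refine ⟨A * V * diagonal fun k : Fin r => (singularValue A k)⁻¹, V, ?_, hV, ?_⟩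
  · have h2 : (A * V)ᵀ * (A * V) = diagonal (fun k : Fin r => singularValue A k ^ 2) := by
      rw [transpose_mul, Matrix.mul_assoc, ← Matrix.mul_assoc Aᵀ, hG, Matrix.mul_assoc _ Vᵀ, hV,
        Matrix.mul_one, ← Matrix.mul_assoc, hV, Matrix.one_mul]
    rw [transpose_mul (A * V), diagonal_transpose, Matrix.mul_assoc, ← Matrix.mul_assoc (A * V)ᵀ,
      h2, diagonal_mul_diagonal, diagonal_mul_diagonal, ← diagonal_one]
    congr 1
    ext k
    have := hpos k
    field_simp
  · rw [Matrix.mul_assoc (A * V), diagonal_mul_diagonal]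
    simp only [inv_mul_cancel₀ (hpos _)]
    rw [diagonal_one, Matrix.mul_one, hAV]

end PowerSums
-- The optimal factorization
theorem exists_transpose_mul_self_eq_one {r n : ℕ} (h : r ≤ n) :
    ∃ E : Matrix (Fin n) (Fin r) ℝ, Eᵀ * E = 1 :=
  ⟨_, transpose_mul_self_submatrix_castLE (W := 1) h (by rw [transpose_one, Matrix.one_mul])⟩

theorem chainProd_mul_diagonal_mul {r N : ℕ} (d : Fin (N + 2) → ℕ)
    (E : (i : Fin (N + 2)) → Matrix (Fin (d i)) (Fin r) ℝ) (hE : ∀ i, (E i)ᵀ * E i = 1)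
    (w : Fin (N + 1) → Fin r → ℝ) :
    chainProd d (fun i => E i.castSucc * diagonal (w i) * (E i.succ)ᵀ) =
      E 0 * diagonal (fun k => ∏ i, w i k) * (E (Fin.last _))ᵀ := by
  induction N with
  | zero =>
    have h : ∀ d : Fin (0 + 2) → ℕ, ∀ R : FactorChain d, chainProd d R = R 0 := fun d R => by
      simp only [chainProd]
      exact Matrix.mul_one _
    rw [h]
    simp only [Fin.prod_univ_succ, univ_eq_empty, prod_empty, mul_one]
    rfl
  | succ N ih =>
    have h := ih (fun i => d i.succ) (fun i => E i.succ) (fun i => hE i.succ) fun i => w i.succ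
    have h2 : chainProd d (fun i => E i.castSucc * diagonal (w i) * (E i.succ)ᵀ) =
        (E 0 * diagonal (w 0) * (E (Fin.succ 0))ᵀ) *
          (E (Fin.succ 0) * diagonal (fun k => ∏ i : Fin (N + 1), w i.succ k) *
            (E (Fin.last _).succ)ᵀ) := by
      rw [← h]
      rfl
    rw [h2, Matrix.mul_assoc _ (E (Fin.succ 0))ᵀ, ← Matrix.mul_assoc (E (Fin.succ 0))ᵀ,
      ← Matrix.mul_assoc (E (Fin.succ 0))ᵀ, hE, Matrix.one_mul, Matrix.mul_assoc (E 0),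
      ← Matrix.mul_assoc (diagonal _), diagonal_mul_diagonal, ← Matrix.mul_assoc (E 0)]
    simp only [Fin.prod_univ_succ]
    rfl

theorem exists_chainProd_eq_and_factorCost_eq {N : ℕ} (hN : 1 ≤ N) {d : Fin (N + 1) → ℕ}
    (A : Matrix (Fin (d 0)) (Fin (d (Fin.last N))) ℝ)
    (hd : ∀ i, i ≠ 0 → i ≠ Fin.last N → A.rank ≤ d i)
    {p : ℝ} {q : Fin N → ℝ} (hp : 0 < p) (hq : ∀ j, 0 < q j) (hpq : ∑ j, 1 / q j = 1 / p) :
    ∃ R : FactorChain d, chainProd d R = A ∧ factorCost p q R = schattenNorm p A := by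
  obtain ⟨N, rfl⟩ : ∃ M, N = M + 1 := ⟨N - 1, by omega⟩
  obtain ⟨U, V, hU, hV, hA⟩ := exists_singular_value_decomposition A
  have hE : ∃ E : (i : Fin (N + 2)) → Matrix (Fin (d i)) (Fin A.rank) ℝ,
      (∀ i, (E i)ᵀ * E i = 1) ∧ E 0 = U ∧ E (Fin.last _) = V := by
    -- Transport along `0 = i` and `last = i` prescribes the end matrices inside a single dependent
    -- choice.
    have h : ∀ i, ∃ E : Matrix (Fin (d i)) (Fin A.rank) ℝ, Eᵀ * E = 1 ∧
        (∀ h : 0 = i, E = h ▸ U) ∧ ∀ h : Fin.last (N + 1) = i, E = h ▸ V := by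
      intro i
      by_cases h0 : 0 = i
      · subst h0
        exact ⟨U, hU, fun _ => rfl, fun h => absurd h (Fin.last_pos).ne'⟩
      by_cases h1 : Fin.last (N + 1) = i
      · subst h1
        exact ⟨V, hV, fun h => absurd h h0, fun _ => rfl⟩
      obtain ⟨E, hE⟩ := exists_transpose_mul_self_eq_one (hd i (Ne.symm h0) (Ne.symm h1))
      exact ⟨E, hE, fun h => absurd h h0, fun h => absurd h h1⟩
    choose E hE h0 h1 using h
    exact ⟨E, hE, h0 0 rfl, h1 _ rfl⟩
  obtain ⟨E, hE, h0, h1⟩ := hE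
  have hs : ∀ k : Fin A.rank, 0 < singularValue A k := fun k => (singularValue_pos_iff A).2 k.2
  have hsum : ∑ j, p / q j = 1 := by
    simp only [div_eq_mul_one_div p, ← mul_sum, hpq]
    exact mul_one_div_cancel hp.ne'
  refine ⟨fun i => E i.castSucc * diagonal (fun k : Fin A.rank => singularValue A k ^ (p / q i)) *
    (E i.succ)ᵀ, ?_, ?_⟩
  · rw [chainProd_mul_diagonal_mul d E hE fun i k => singularValue A k ^ (p / q i), h0, h1]
    simp only [← Real.rpow_sum_of_pos (hs _), hsum, Real.rpow_one]
    exact hA.symm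
  -- Raising `Σ ^ (p / q j)` to the power `q j` gives `Σ ^ p`, so every factor contributes the same
  -- amount.
  · have hcost : ∀ j, schattenNorm (q j) (E j.castSucc *
        diagonal (fun k : Fin A.rank => singularValue A k ^ (p / q j)) * (E j.succ)ᵀ) ^ q j =
        schattenNorm p A ^ p := by
      intro j
      rw [schattenNorm_rpow_mul_diagonal_mul (hE _) (hE _)
        (fun k => Real.rpow_nonneg (hs k).le _) (hq j), schattenNorm_rpow A hp,
        ← Fin.sum_univ_eq_sum_range (fun i => singularValue A i ^ p)]
      refine sum_congr rfl fun k _ => ?_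
      rw [← Real.rpow_mul (hs k).le, div_mul_cancel₀ _ (hq j).ne']
    simp only [factorCost, hcost]
    rw [← sum_mul, ← mul_assoc, hpq, mul_one_div_cancel hp.ne', one_mul,
      ← Real.rpow_mul (schattenNorm_nonneg A p), mul_one_div_cancel hp.ne', Real.rpow_one]

/-! ### The minima and the infinitude of factorizations -/

theorem mem_factorizations_iff {N : ℕ} {d : Fin (N + 1) → ℕ}
    (A : Matrix (Fin (d 0)) (Fin (d (Fin.last N))) ℝ) (R : FactorChain d) :
    R ∈ factorizations A d ↔ chainProd d R = A :=
  ⟨fun ⟨_, _, h⟩ => h, fun h => ⟨rfl, rfl, h⟩⟩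

theorem isLeast_factorCost {m n N : ℕ} (hN : 1 ≤ N) (A : Matrix (Fin m) (Fin n) ℝ)
    {d : Fin (N + 1) → ℕ} (hd : AdmissibleDims m n A.rank d)
    {p : ℝ} {q : Fin N → ℝ} (hp : 0 < p) (hq : ∀ j, 0 < q j) (hpq : ∑ j, 1 / q j = 1 / p) :
    IsLeast {x : ℝ | ∃ R ∈ factorizations A d, x = factorCost p q R} (schattenNorm p A) := by
  obtain ⟨rfl, rfl, hd⟩ := hd
  constructor
  · obtain ⟨R, hR, hc⟩ := exists_chainProd_eq_and_factorCost_eq hN A hd hp hq hpq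
    exact ⟨R, (mem_factorizations_iff A R).2 hR, hc.symm⟩
  · rintro x ⟨R, hR, rfl⟩
    rw [← (mem_factorizations_iff A R).1 hR]
    exact schattenNorm_chainProd_le_factorCost d R hp hq hpq

theorem exists_admissibleDims {N : ℕ} (hN : 1 ≤ N) (m n r : ℕ) :
    ∃ d : Fin (N + 1) → ℕ, AdmissibleDims m n r d := by
  have h0 : Fin.last N ≠ 0 := by
    rw [ne_eq, Fin.ext_iff]
    simp
    omega
  refine ⟨fun i => if i = 0 then m else if i = Fin.last N then n else r, by simp, by simp [h0], ?_⟩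
  intro i hi hl
  simp [hi, hl]

theorem factorizations_infinite {m n N : ℕ} (hN : 2 ≤ N) (A : Matrix (Fin m) (Fin n) ℝ)
    {d : Fin (N + 1) → ℕ} (hd : AdmissibleDims m n A.rank d) (hpos : ∀ i, 0 < d i) :
    (factorizations A d).Infinite := by
  obtain ⟨N, rfl⟩ : ∃ M, N = M + 2 := ⟨N - 2, by omega⟩
  obtain ⟨rfl, rfl, hd⟩ := hd
  -- A nonzero first factor makes the rescaled chains distinct. For `A = 0` it is the all-ones
  -- matrix, nonzero as the sizes are positive, followed by zeros.
  obtain ⟨X, Y, T, hA, hX⟩ : ∃ (X : Matrix (Fin (d 0)) (Fin (d (Fin.succ 0))) ℝ)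
      (Y : Matrix (Fin (d (Fin.succ 0))) (Fin (d (Fin.succ (Fin.succ 0)))) ℝ)
      (T : FactorChain fun i : Fin (N + 1) => d i.succ.succ), X * (Y * chainProd _ T) = A ∧
        X ≠ 0 := by
    by_cases hA : A = 0
    · refine ⟨of fun _ _ => 1, 0, fun _ => 0, ?_, fun h => ?_⟩
      · rw [hA, Matrix.zero_mul]
        exact Matrix.mul_zero _
      · have h1 : (1 : ℝ) = 0 := congrFun (congrFun h ⟨0, hpos _⟩) ⟨0, hpos _⟩
        exact one_ne_zero h1
    -- Any valid exponents would do: only the existence of a factorization is used.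
    · have hq : ∑ j : Fin (N + 2), 1 / (fun _ => (N + 2 : ℝ)) j = 1 / 1 := by
        simp
        field_simp
      obtain ⟨S, hS, -⟩ := exists_chainProd_eq_and_factorCost_eq (by omega) A hd one_pos
        (fun _ => by positivity) hq
      refine ⟨S 0, S (Fin.succ 0), fun i => S i.succ.succ, hS, fun h => hA ?_⟩
      rw [← hS]
      simp only [chainProd, h]
      exact Matrix.zero_mul _
  let F : ℝ → FactorChain d := fun c => Fin.cons (Real.exp c • X) (Fin.cons (Real.exp (-c) • Y) T)
  refine Set.infinite_of_injective_forall_mem (f := F) ?_ ?_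
  · intro a b hab
    have h0 : Real.exp a • X = Real.exp b • X := congrFun hab 0
    exact Real.exp_injective (smul_left_injective ℝ hX h0)
  · intro c
    have h : (Real.exp c • X) * ((Real.exp (-c) • Y) * chainProd _ T) = A := by
      rw [← hA, Matrix.smul_mul, Matrix.smul_mul, Matrix.mul_smul, smul_smul, ← Real.exp_add,
        add_neg_cancel, Real.exp_zero, one_smul]
    exact (mem_factorizations_iff A (F c)).2 h

theorem isLeast_frobeniusNorm {m n k : ℕ} (A : Matrix (Fin m) (Fin n) ℝ) (hk : A.rank ≤ k) :
    IsLeast {x : ℝ | ∃ (R₁ : Matrix (Fin m) (Fin k) ℝ) (R₂ : Matrix (Fin k) (Fin n) ℝ),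
      R₁ * R₂ = A ∧ x = 1 / 2 * (frobeniusNorm R₁ ^ 2 + frobeniusNorm R₂ ^ 2)}
      (nuclearNorm A) := by
  have hd : AdmissibleDims m n A.rank ![m, k, n] := by
    refine ⟨rfl, rfl, fun i => ?_⟩
    fin_cases i
    · simp
    · exact fun _ _ => hk
    · exact fun _ h => absurd rfl h
  have h := isLeast_factorCost (p := 1) (q := fun _ => 2) one_le_two A hd one_pos
    (fun _ => two_pos) (by norm_num)
  rw [nuclearNorm_eq_schattenNorm]
  convert h using 1
  let pair (R₁ : Matrix (Fin m) (Fin k) ℝ) (R₂ : Matrix (Fin k) (Fin n) ℝ) :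
      FactorChain ![m, k, n] := Fin.cons R₁ (Fin.cons R₂ fun i => i.elim0)
  have hpair : ∀ R : FactorChain ![m, k, n], R = pair (R 0) (R 1) := by
    intro R
    funext i
    fin_cases i <;> rfl
  have hcost : ∀ R₁ R₂, factorCost 1 (fun _ => 2) (pair R₁ R₂) =
      1 / 2 * (frobeniusNorm R₁ ^ 2 + frobeniusNorm R₂ ^ 2) := by
    intro R₁ R₂
    rw [frobeniusNorm_sq, frobeniusNorm_sq, factorCost, Fin.sum_univ_two, one_mul, div_one,
      Real.rpow_one, mul_add]
    rfl
  have hmem : ∀ R₁ R₂, pair R₁ R₂ ∈ factorizations A ![m, k, n] ↔ R₁ * R₂ = A := by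
    intro R₁ R₂
    refine (mem_factorizations_iff (d := ![m, k, n]) A (pair R₁ R₂)).trans ?_
    have h : chainProd ![m, k, n] (pair R₁ R₂) = R₁ * R₂ :=
      congrArg (fun M : Matrix (Fin k) (Fin n) ℝ => R₁ * M) (Matrix.mul_one R₂)
    rw [h]
    rfl
  ext x
  constructor
  · rintro ⟨R₁, R₂, hR, rfl⟩
    exact ⟨pair R₁ R₂, (hmem R₁ R₂).2 hR, (hcost R₁ R₂).symm⟩
  · rintro ⟨R, hR, rfl⟩
    rw [hpair R] at hR
    exact ⟨R 0, R 1, (hmem _ _).1 hR, (congrArg _ (hpair R)).trans (hcost _ _)⟩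

theorem proposition1 {m n N : ℕ} (hN : 1 ≤ N) (A : Matrix (Fin m) (Fin n) ℝ) :
    -- infinitely many factorizations, for each choice of (positive) sizes
    (2 ≤ N → ∀ d : Fin (N + 1) → ℕ, AdmissibleDims m n A.rank d → (∀ i, 0 < d i) →
      (factorizations A d).Infinite) ∧
    -- the Schatten norm as a minimum, for each choice of sizes and over all of them
    (∀ (p : ℝ) (q : Fin N → ℝ), 0 < p → p ≤ 1 → (∀ i, 0 < q i) → ∑ i, 1 / q i = 1 / p →
      (∀ d : Fin (N + 1) → ℕ, AdmissibleDims m n A.rank d →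
        IsLeast {x : ℝ | ∃ R ∈ factorizations A d, x = factorCost p q R} (schattenNorm p A)) ∧
      IsLeast {x : ℝ | ∃ d : Fin (N + 1) → ℕ, AdmissibleDims m n A.rank d ∧
        ∃ R ∈ factorizations A d, x = factorCost p q R} (schattenNorm p A)) ∧
    -- the special case of the nuclear norm and two factors
    (∀ k : ℕ, A.rank ≤ k →
      IsLeast {x : ℝ | ∃ (R₁ : Matrix (Fin m) (Fin k) ℝ) (R₂ : Matrix (Fin k) (Fin n) ℝ),
        R₁ * R₂ = A ∧ x = 1 / 2 * (frobeniusNorm R₁ ^ 2 + frobeniusNorm R₂ ^ 2)}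
        (nuclearNorm A)) ∧
    IsLeast {x : ℝ | ∃ (k : ℕ) (R₁ : Matrix (Fin m) (Fin k) ℝ) (R₂ : Matrix (Fin k) (Fin n) ℝ),
        R₁ * R₂ = A ∧ x = 1 / 2 * (frobeniusNorm R₁ ^ 2 + frobeniusNorm R₂ ^ 2)}
        (nuclearNorm A) := by
  refine ⟨fun h d hd hpos => factorizations_infinite h A hd hpos, fun p q hp _ hq hpq => ?_,
    fun k hk => isLeast_frobeniusNorm A hk, ?_, ?_⟩
  · refine ⟨fun d hd => isLeast_factorCost hN A hd hp hq hpq, ?_, ?_⟩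
    · obtain ⟨d, hd⟩ := exists_admissibleDims hN m n A.rank
      exact ⟨d, hd, (isLeast_factorCost hN A hd hp hq hpq).1⟩
    · rintro x ⟨d, hd, hx⟩
      exact (isLeast_factorCost hN A hd hp hq hpq).2 hx
  · exact ⟨A.rank, (isLeast_frobeniusNorm A le_rfl).1⟩
  · rintro x ⟨k, R₁, R₂, rfl, rfl⟩
    -- A factorization through `k` forces the rank to be at most `k`, so arbitrary `k` reduces to
    -- the fixed case.
    exact (isLeast_frobeniusNorm (R₁ * R₂) ((rank_mul_le_left R₁ R₂).trans (rank_le_width R₁))).2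
      ⟨R₁, R₂, rfl, rfl⟩
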